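/- Let $(X,\mu)$ be a standard probability space (a standard Borel space with a Borel probability measure), and let $\mathcal{G}$ be a simple graph with vertex set $X$ whose edge relation is a Borel subset of $X\times X$ and in which every vertex has finitely many neighbours. Suppose that $\mathcal{G}$ is measure preserving: for every Borel set $A\subseteq X$ and every injective Borel map $f:A\to X$ such that $f(x)$ lies in the $\mathcal{G}$-connected component of $x$ for all $x\in A$, one has $\mu(f(A))=\mu(A)$. Suppose also that $\mathcal{G}$ has superquadratic growth: there is a $c>0$ such that $|B_r(x)|\geq c\,r^2$ for every $x\in X$ and every $r\in\mathbb{N}$, where $B_r(x)$ is the ball of radius $r$ around $x$ in the graph metric of $\mathcal{G}$. Then $\mathcal{G}$ has a Borel a.e. one-ended spanning subforest, that is, there is an acyclic subgraph $\mathcal{T}\subseteq\mathcal{G}$ with the same vertex set $X$, whose edge relation is Borel in $X\times X$, such that for $\mu$-almost every $x\in X$ the connected component of $x$ in $\mathcal{T}$ is a tree with exactly one end. -/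

import Mathlib

open MeasureTheory

namespace SimpleGraph

/-- A simple graph on a measurable space `X` is *Borel* if its edge relation is a Borel subset
of `X × X`. -/
def IsBorel {X : Type*} [MeasurableSpace X] (G : SimpleGraph X) : Prop :=
  MeasurableSet {p : X × X | G.Adj p.1 p.2}

/-- Every vertex has finitely many neighbours. -/
def IsLocFinite {X : Type*} (G : SimpleGraph X) : Prop :=
  ∀ x : X, (G.neighborSet x).Finite

/-- The graph `G` is *measure preserving* for `μ`: its connectedness equivalence relation
preserves `μ`, that is, every Borel partial injection `f : A → X` that moves each point of its
Borel domain `A` inside its connected component satisfies `μ (f '' A) = μ A`. -/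
def IsMeasurePreserving {X : Type*} [MeasurableSpace X] (G : SimpleGraph X) (μ : Measure X) :
    Prop :=
  ∀ (A : Set X) (f : X → X), MeasurableSet A → Measurable f → Set.InjOn f A →
    (∀ x ∈ A, G.Reachable x (f x)) → μ (f '' A) = μ A

/-- The (closed) ball of radius `r` around `x` in the graph metric: the vertices that can be
joined to `x` by a path with at most `r` edges. -/
def graphBall {X : Type*} (G : SimpleGraph X) (x : X) (r : ℕ) : Set X :=
  {y : X | G.edist x y ≤ r}

/-- The graph has exactly one end. Finite graphs have no end, so they are not one-ended. -/
def IsOneEnded {V : Type*} (H : SimpleGraph V) : Prop :=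
  ∃! e, e ∈ H.end

/-- `T` is a *Borel `μ`-a.e. one-ended spanning subforest* of `G`: a Borel acyclic subgraph of `G`
on the same vertex set, such that for `μ`-almost every vertex `x` the connected component of `x`
in `T` (which is a tree) has exactly one end. -/
structure IsBorelAEOneEndedSpanningSubforest {X : Type*} [MeasurableSpace X]
    (G : SimpleGraph X) (μ : Measure X) (T : SimpleGraph X) : Prop where
  le : T ≤ G
  borel : T.IsBorel
  acyclic : T.IsAcyclic
  ae_oneEnded : ∀ᵐ x ∂μ, (T.connectedComponentMk x).toSimpleGraph.IsOneEnded

end SimpleGraph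

/-!
The forest is the graph of a Borel function `f` moving almost every vertex `x` to a neighbour. Let
`C n` be a Borel maximal set of vertices at pairwise distance greater than `2 n ^ 2`. The balls of
radius `n ^ 2` around the points of `C n` are disjoint, so quadratic growth and measure preservation
bound `μ (C n)` by a multiple of `n ^ (-4)`
(`SimpleGraph.IsMeasurePreserving.mul_measure_le_one`). By maximality, each point of `C n` is joined
to `C (n + 1)` by a path of length at most `2 (n + 1) ^ 2`, and with Borel choices of next steps the
union `P n` of these paths has measure of order `n ^ (-2)`. By the Borel–Cantelli lemma, almost
every vertex lies in only finitely many `P n`. As `C 0` is the whole space, such a vertex `x` lies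
in a last `P n`, and `f x` is the next vertex on the way to `C (n + 1)`.

Along the orbits of `f`, the index `n` followed by the progress towards `C (n + 1)` increases
lexicographically. The progress is bounded and the order is well-founded. So `f` has no cycles, and,
being finite-to-one, it has finite backward orbits; any component of its graph on which it has no
fixed points is then one-ended (`SimpleGraph.functionGraph_component_isOneEnded`). The fixed points
lie in the null set of vertices in infinitely many `P n`, and by measure preservation the union of
the components meeting this null set is null.

All choices are Borel because the neighbours of a vertex are enumerated by countably many Borel
functions (`exists_measurable_enumeration`). This rests on the fact that projections of Borel sets
with finite sections are Borel (`measurableSet_image_fst_of_finite`), which is deduced from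
Novikov's separation theorem for sequences of analytic sets and the Lusin–Souslin theorem.
-/

universe u

/-! ### Borel sets with finite sections -/

/-- **Novikov's separation theorem**: countably many analytic sets with empty intersection can be
enlarged to Borel sets with empty intersection. -/
theorem MeasureTheory.AnalyticSet.exists_measurableSet_superset_iInter_eq_empty {α : Type*}
    [TopologicalSpace α] [T2Space α] [MeasurableSpace α] [OpensMeasurableSpace α]
    {A : ℕ → Set α} (hA : ∀ n, AnalyticSet (A n)) (h : ⋂ n, A n = ∅) :
    ∃ B : ℕ → Set α, (∀ n, A n ⊆ B n ∧ MeasurableSet (B n)) ∧ ⋂ n, B n = ∅ := by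
  classical
  by_contra hsep
  have hne : ∀ n, A n ≠ ∅ := by
    intro n hn
    refine hsep ⟨fun k => if k = n then ∅ else Set.univ, fun k => ?_, ?_⟩
    · by_cases hk : k = n
      · subst hk; simp [hn]
      · simp [hk]
    · ext x
      simp only [Set.mem_iInter, Set.mem_empty_iff_false, iff_false, not_forall]
      exact ⟨n, by simp⟩
  have hpar : ∀ n, ∃ f : (ℕ → ℕ) → α, Continuous f ∧ Set.range f = A n := by
    intro n
    have := hA n
    rw [AnalyticSet] at this
    exact this.resolve_left (hne n)
  choose f hf hfr using hpar
  -- All parametrising sequences are encoded in one sequence `t`: digit `j` of the parameter of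
  -- `A n` is `t (Nat.pair n j)`, so that fixing `t` below `s` fixes finitely many digits in all.
  let S : (ℕ → ℕ) → ℕ → ℕ → Set α := fun t s n =>
    f n '' {u | ∀ j, Nat.pair n j < s → u j = t (Nat.pair n j)}
  let Sep : (ℕ → Set α) → Prop := fun T =>
    ∃ B : ℕ → Set α, (∀ n, T n ⊆ B n ∧ MeasurableSet (B n)) ∧ ⋂ n, B n = ∅
  have h0 : ¬ Sep (S 0 0) := by
    have : S 0 0 = A := by
      funext n
      simp [S, hfr]
    rw [this]
    exact hsep
  have hstep : ∀ t s, ¬ Sep (S t s) → ∃ m, ¬ Sep (S (Function.update t s m) (s + 1)) := by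
    intro t s hns
    by_contra hcon
    push Not at hcon
    choose B hB hBe using hcon
    apply hns
    set n₀ := (Nat.unpair s).1 with hn₀
    refine ⟨fun n => if n = n₀ then ⋃ m, B m n else ⋂ m, B m n, fun n => ?_, ?_⟩
    · by_cases hn : n = n₀
      · simp only [hn, if_true]
        refine ⟨?_, MeasurableSet.iUnion fun m => (hB m n₀).2⟩
        rintro _ ⟨u, hu, rfl⟩
        refine Set.mem_iUnion.2 ⟨u (Nat.unpair s).2, (hB _ n₀).1 ⟨u, fun j hj => ?_, rfl⟩⟩
        by_cases hjs : Nat.pair n₀ j = s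
        · rw [hjs, Function.update_self, ← hjs, Nat.unpair_pair]
        · rw [Function.update_of_ne hjs]
          exact hu j (by omega)
      · simp only [hn, if_false]
        refine ⟨?_, MeasurableSet.iInter fun m => (hB m n).2⟩
        rintro _ ⟨u, hu, rfl⟩
        refine Set.mem_iInter.2 fun m => (hB m n).1 ⟨u, fun j hj => ?_, rfl⟩
        have hjs : Nat.pair n j ≠ s := by
          intro hs
          apply hn
          rw [hn₀, ← hs, Nat.unpair_pair]
        rw [Function.update_of_ne hjs]
        exact hu j (by omega)
    · ext x
      simp only [Set.mem_iInter, Set.mem_empty_iff_false, iff_false]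
      intro hx
      have h1 := hx n₀
      simp only [if_true, Set.mem_iUnion] at h1
      obtain ⟨m, hm⟩ := h1
      have : x ∈ ⋂ n, B m n := by
        refine Set.mem_iInter.2 fun n => ?_
        by_cases hn : n = n₀
        · rw [hn]; exact hm
        · have h2 := hx n
          simp only [hn, if_false, Set.mem_iInter] at h2
          exact h2 m
      rw [hBe m] at this
      exact this
  choose! nxt hnxt using hstep
  let p : ∀ s : ℕ, {t : ℕ → ℕ // ¬ Sep (S t s)} := fun s =>
    Nat.rec ⟨0, h0⟩ (fun s t => ⟨Function.update t.1 s (nxt t.1 s), hnxt t.1 s t.2⟩) s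
  have hp : ∀ s, (p (s + 1)).1 = Function.update (p s).1 s (nxt (p s).1 s) := fun s => rfl
  have hpc : ∀ s i, i < s → (p s).1 i = (p (i + 1)).1 i := by
    intro s
    induction s with
    | zero => intro i hi; omega
    | succ s ih =>
      intro i hi
      rcases Nat.lt_succ_iff_lt_or_eq.1 hi with hi | rfl
      · rw [hp, Function.update_of_ne (by omega), ih i hi]
      · rfl
  let x : ℕ → ℕ → ℕ := fun n j => (p (Nat.pair n j + 1)).1 (Nat.pair n j)
  have hx : ∃ i j, f i (x i) ≠ f j (x j) := by
    by_contra hcon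
    push Not at hcon
    have : f 0 (x 0) ∈ ⋂ n, A n := by
      refine Set.mem_iInter.2 fun n => ?_
      rw [← hfr n, hcon 0 n]
      exact ⟨_, rfl⟩
    rw [h] at this
    exact this
  have hcyl : ∀ n (U : Set α), IsOpen U → f n (x n) ∈ U → ∃ s₀, ∀ s ≥ s₀, S (p s).1 s n ⊆ U := by
    intro n U hU hxU
    have hU' : f n ⁻¹' U ∈ nhds (x n) := (hU.preimage (hf n)).mem_nhds hxU
    rw [nhds_pi, Filter.mem_pi'] at hU'
    obtain ⟨I, V, hV, hIV⟩ := hU'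
    refine ⟨I.sup (fun j => Nat.pair n j) + 1, fun s hs => ?_⟩
    rintro _ ⟨u, hu, rfl⟩
    refine hIV fun j hj => ?_
    have hjs : Nat.pair n j < s :=
      lt_of_lt_of_le (Nat.lt_succ_of_le (Finset.le_sup (f := fun j => Nat.pair n j) hj)) hs
    rw [hu j hjs, hpc s _ hjs]
    exact mem_of_mem_nhds (hV j)
  obtain ⟨i, j, hij⟩ := hx
  obtain ⟨U, V, hU, hV, hiU, hjV, hUV⟩ := t2_separation hij
  obtain ⟨s₁, hs₁⟩ := hcyl i U hU hiU
  obtain ⟨s₂, hs₂⟩ := hcyl j V hV hjV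
  have hne' : i ≠ j := by rintro rfl; exact hij rfl
  refine (p (max s₁ s₂)).2 ⟨fun n => if n = i then U else if n = j then V else Set.univ,
    fun n => ?_, ?_⟩
  · by_cases hn : n = i
    · simp only [hn, if_true]
      exact ⟨hs₁ _ (le_max_left _ _), hU.measurableSet⟩
    · by_cases hn' : n = j
      · simp only [hn', hne'.symm, if_false, if_true]
        exact ⟨hs₂ _ (le_max_right _ _), hV.measurableSet⟩
      · simp [hn, hn']
  · ext y
    simp only [Set.mem_iInter, Set.mem_empty_iff_false, iff_false]
    intro hy
    have h1 := hy i
    have h2 := hy j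
    simp only [if_true, hne'.symm, if_false] at h1 h2
    exact Set.disjoint_left.1 hUV h1 h2

/-- The relation over `X × Y` whose section at a point `(x, y)` of `R` is the set of the elements
of the section of `R` at `x` that lie below `y`. The order on `Y` is pulled back from `ℝ` along
`embeddingReal Y`. -/
def belowRel {X Y : Type*} [MeasurableSpace Y] [StandardBorelSpace Y] (R : Set (X × Y)) :
    Set ((X × Y) × Y) :=
  {q | q.1 ∈ R ∧ (q.1.1, q.2) ∈ R ∧ embeddingReal Y q.2 < embeddingReal Y q.1.2}

theorem measurableSet_belowRel {X Y : Type*} [MeasurableSpace X] [MeasurableSpace Y]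
    [StandardBorelSpace Y] {R : Set (X × Y)} (hR : MeasurableSet R) :
    MeasurableSet (belowRel R) := by
  have hj := (measurableEmbedding_embeddingReal Y).measurable
  refine (measurable_fst hR).inter (MeasurableSet.inter ?_ ?_)
  · exact ((measurable_fst.comp measurable_fst).prodMk measurable_snd) hR
  · exact measurableSet_lt (hj.comp measurable_snd) (hj.comp (measurable_snd.comp measurable_fst))

/-- The set of pairs `(x, y)` such that `y` is the least element of the section of `R` at `x`. -/
def minRel {X Y : Type*} [MeasurableSpace Y] [StandardBorelSpace Y] (R : Set (X × Y)) :
    Set (X × Y) :=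
  R \ (Prod.fst '' belowRel R)

theorem minRel_le {X Y : Type*} [MeasurableSpace Y] [StandardBorelSpace Y] {R : Set (X × Y)}
    {x : X} {y y' : Y} (h : (x, y) ∈ minRel R) (h' : (x, y') ∈ R) :
    embeddingReal Y y ≤ embeddingReal Y y' := by
  by_contra hlt
  exact h.2 ⟨((x, y), y'), ⟨h.1, h', not_le.1 hlt⟩, rfl⟩

theorem minRel_unique {X Y : Type*} [MeasurableSpace Y] [StandardBorelSpace Y] {R : Set (X × Y)}
    {x : X} {y y' : Y} (h : (x, y) ∈ minRel R) (h' : (x, y') ∈ minRel R) : y = y' :=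
  (measurableEmbedding_embeddingReal Y).injective
    (le_antisymm (minRel_le h h'.1) (minRel_le h' h.1))

theorem injOn_fst_minRel {X Y : Type*} [MeasurableSpace Y] [StandardBorelSpace Y]
    (R : Set (X × Y)) : Set.InjOn Prod.fst (minRel R) := by
  rintro ⟨x, y⟩ h ⟨x', y'⟩ h' hx
  obtain rfl : x = x' := hx
  rw [minRel_unique h h']

theorem exists_mem_minRel {X Y : Type*} [MeasurableSpace Y] [StandardBorelSpace Y]
    {R : Set (X × Y)} {x : X} (hfin : {y | (x, y) ∈ R}.Finite) (hne : ∃ y, (x, y) ∈ R) :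
    ∃ y, (x, y) ∈ minRel R := by
  obtain ⟨y, hy, hmin⟩ := Set.exists_min_image _ (embeddingReal Y) hfin hne
  refine ⟨y, hy, ?_⟩
  rintro ⟨⟨⟨x', y'⟩, z⟩, ⟨-, hz, hlt⟩, hq⟩
  obtain ⟨rfl, rfl⟩ : x' = x ∧ y' = y := by simpa using hq
  exact absurd (hmin z hz) (not_le.2 hlt)

/-- Every nonempty finite section has a least element. If the sections have at most `n + 1`
elements, those of `belowRel R` have at most `n`, so `minRel R` is Borel by induction, and
`Prod.fst` is injective on it. -/
theorem measurableSet_image_fst_of_ncard_le (n : ℕ) :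
    ∀ {X Y : Type u} [MeasurableSpace X] [MeasurableSpace Y] [StandardBorelSpace X]
      [StandardBorelSpace Y] {R : Set (X × Y)}, MeasurableSet R →
      (∀ x, {y | (x, y) ∈ R}.Finite ∧ {y | (x, y) ∈ R}.ncard ≤ n) →
      MeasurableSet (Prod.fst '' R) := by
  induction n with
  | zero =>
    intro X Y _ _ _ _ R hR hn
    have : R = ∅ := by
      ext ⟨x, y⟩
      simp only [Set.mem_empty_iff_false, iff_false]
      intro h
      have h0 := (Set.ncard_eq_zero (hn x).1).1 (Nat.le_zero.1 (hn x).2)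
      exact (Set.eq_empty_iff_forall_notMem.1 h0) y h
    simp [this]
  | succ n ih =>
    intro X Y _ _ _ _ R hR hn
    have hB : MeasurableSet (Prod.fst '' belowRel R) := by
      refine ih (measurableSet_belowRel hR) ?_
      rintro ⟨x, y⟩
      by_cases hxy : (x, y) ∈ R
      · have hsub : {z | ((x, y), z) ∈ belowRel R} ⊆ {z | (x, z) ∈ R} \ {y} := by
          rintro z ⟨-, hz, hlt⟩
          refine ⟨hz, ?_⟩
          rintro rfl
          exact lt_irrefl _ hlt
        refine ⟨((hn x).1.sdiff).subset hsub, ?_⟩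
        refine (Set.ncard_le_ncard hsub ((hn x).1.sdiff)).trans ?_
        have hy : y ∈ {z | (x, z) ∈ R} := hxy
        rw [Set.ncard_sdiff_singleton_of_mem hy]
        have := (hn x).2
        omega
      · have : {z | ((x, y), z) ∈ belowRel R} = ∅ := by
          ext z
          simp only [Set.mem_empty_iff_false, iff_false]
          exact fun h => hxy h.1
        rw [this]
        simp
    have hM : MeasurableSet (minRel R) := hR.diff hB
    have : Prod.fst '' R = Prod.fst '' minRel R := by
      ext x
      constructor
      · rintro ⟨⟨x', y⟩, h, rfl⟩
        obtain ⟨z, hz⟩ := exists_mem_minRel (hn x').1 ⟨y, h⟩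
        exact ⟨(x', z), hz, rfl⟩
      · rintro ⟨q, h, rfl⟩
        exact ⟨q, h.1, rfl⟩
    rw [this]
    exact hM.image_of_measurable_injOn measurable_fst (injOn_fst_minRel R)

/-- The projection of a Borel set with finite sections is Borel. The sets of points whose section
has at least `n` elements are analytic with empty intersection; Novikov's theorem then splits the
space into countably many Borel pieces over each of which the sections have bounded size. -/
theorem measurableSet_image_fst_of_finite {X Y : Type u} [MeasurableSpace X] [MeasurableSpace Y]
    [StandardBorelSpace X] [StandardBorelSpace Y] {R : Set (X × Y)} (hR : MeasurableSet R)
    (hfin : ∀ x, {y | (x, y) ∈ R}.Finite) : MeasurableSet (Prod.fst '' R) := by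
  let := upgradeStandardBorel X
  let D : ℕ → Set X := fun n => Prod.fst '' {q : X × (Fin n → Y) |
    (∀ i, (q.1, q.2 i) ∈ R) ∧ ∀ i j, i ≠ j → q.2 i ≠ q.2 j}
  have hDmem : ∀ n x, x ∈ D n ↔ n ≤ {y | (x, y) ∈ R}.ncard := by
    intro n x
    constructor
    · rintro ⟨⟨x', v⟩, ⟨h1, h2⟩, rfl⟩
      have hinj : Function.Injective v := fun i j hij => by
        by_contra hne
        exact h2 i j hne hij
      calc n = (Set.range v).ncard := by
              rw [Set.ncard_range_of_injective hinj, Nat.card_eq_fintype_card, Fintype.card_fin]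
        _ ≤ _ := Set.ncard_le_ncard (by rintro _ ⟨i, rfl⟩; exact h1 i) (hfin x')
    · intro hn
      obtain ⟨t, hts, htn⟩ := Set.exists_subset_card_eq hn
      have htf : t.Finite := (hfin x).subset hts
      have hcard : Fintype.card (Fin n) = Nat.card t := by
        rw [Fintype.card_fin, Nat.card_coe_set_eq, htn]
      have := htf.fintype
      rw [Nat.card_eq_fintype_card] at hcard
      let v := Fintype.equivOfCardEq hcard
      refine ⟨(x, fun i => v i), ⟨fun i => hts (v i).2, fun i j hij h => hij ?_⟩, rfl⟩
      exact v.injective (Subtype.ext h)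
  have hDan : ∀ n, AnalyticSet (D n) := by
    intro n
    refine MeasurableSet.analyticSet_image (X := X × (Fin n → Y)) ?_ measurable_fst
    have hv : ∀ i, Measurable fun q : X × (Fin n → Y) => q.2 i := fun i =>
      (measurable_pi_apply i).comp measurable_snd
    simp only [Set.ofPred_and, Set.ofPred_forall]
    refine MeasurableSet.inter ?_ ?_
    · exact MeasurableSet.iInter fun i => (measurable_fst.prodMk (hv i)) hR
    · exact MeasurableSet.iInter fun i => MeasurableSet.iInter fun j => MeasurableSet.iInter fun _ =>
        (measurableSet_eq_fun (hv i) (hv j)).compl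
  have hDe : ⋂ n, D n = ∅ := by
    ext x
    simp only [Set.mem_iInter, Set.mem_empty_iff_false, iff_false]
    intro h
    have := (hDmem _ x).1 (h ({y | (x, y) ∈ R}.ncard + 1))
    omega
  obtain ⟨B, hB, hBe⟩ := AnalyticSet.exists_measurableSet_superset_iInter_eq_empty hDan hDe
  have hU : Prod.fst '' R = ⋃ n, Prod.fst '' (R ∩ Prod.fst ⁻¹' (B n)ᶜ) := by
    ext x
    simp only [Set.mem_iUnion]
    constructor
    · rintro ⟨q, hq, rfl⟩
      have : q.1 ∉ ⋂ n, B n := by rw [hBe]; exact fun h => h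
      rw [Set.mem_iInter, not_forall] at this
      obtain ⟨n, hn⟩ := this
      exact ⟨n, q, ⟨hq, hn⟩, rfl⟩
    · rintro ⟨n, q, hq, rfl⟩
      exact ⟨q, hq.1, rfl⟩
  rw [hU]
  refine MeasurableSet.iUnion fun n => ?_
  refine measurableSet_image_fst_of_ncard_le n (hR.inter (measurable_fst (hB n).2.compl)) ?_
  intro x
  by_cases hx : x ∈ B n
  · have : {y | (x, y) ∈ R ∩ Prod.fst ⁻¹' (B n)ᶜ} = ∅ := by
      ext y
      simp [hx]
    rw [this]
    simp
  · have hsub : {y | (x, y) ∈ R ∩ Prod.fst ⁻¹' (B n)ᶜ} ⊆ {y | (x, y) ∈ R} := fun y h => h.1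
    refine ⟨(hfin x).subset hsub, (Set.ncard_le_ncard hsub (hfin x)).trans ?_⟩
    have : x ∉ D n := fun h => hx ((hB n).1 h)
    rw [hDmem] at this
    omega

theorem measurableSet_minRel {X Y : Type u} [MeasurableSpace X] [MeasurableSpace Y]
    [StandardBorelSpace X] [StandardBorelSpace Y] {R : Set (X × Y)} (hR : MeasurableSet R)
    (hfin : ∀ x, {y | (x, y) ∈ R}.Finite) : MeasurableSet (minRel R) := by
  refine hR.diff (measurableSet_image_fst_of_finite (measurableSet_belowRel hR) ?_)
  rintro ⟨x, y⟩
  exact (hfin x).subset fun z hz => hz.2.1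

/-- A Borel relation with finite sections is covered by countably many Borel functions, each
staying inside the relation where it moves a point. -/
theorem exists_measurable_enumeration {X : Type u} [MeasurableSpace X] [StandardBorelSpace X]
    {R : Set (X × X)} (hR : MeasurableSet R) (hfin : ∀ x, {y | (x, y) ∈ R}.Finite) :
    ∃ e : ℕ → X → X, (∀ k, Measurable (e k)) ∧ (∀ k x, e k x = x ∨ (x, e k x) ∈ R) ∧
      ∀ x y, (x, y) ∈ R → ∃ k, e k x = y := by
  classical
  let T : ℕ → Set (X × X) := fun k => (fun S => S \ minRel S)^[k] R
  have hTs : ∀ k, T (k + 1) = T k \ minRel (T k) := fun k => by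
    simp only [T, Function.iterate_succ_apply']
  have hTR : ∀ k, T k ⊆ R := by
    intro k
    induction k with
    | zero => exact subset_rfl
    | succ k ih => rw [hTs]; exact Set.sdiff_subset.trans ih
  have hTf : ∀ k x, {y | (x, y) ∈ T k}.Finite := fun k x =>
    (hfin x).subset fun y hy => hTR k hy
  have hTm : ∀ k, MeasurableSet (T k) := by
    intro k
    induction k with
    | zero => exact hR
    | succ k ih => rw [hTs]; exact ih.diff (measurableSet_minRel ih (hTf k))
  have hTc : ∀ x k, {y | (x, y) ∈ T k}.ncard ≤ {y | (x, y) ∈ R}.ncard - k := by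
    intro x k
    induction k with
    | zero => exact le_rfl
    | succ k ih =>
      by_cases hne : ∃ y, (x, y) ∈ T k
      · obtain ⟨z, hz⟩ := exists_mem_minRel (hTf k x) hne
        have hsub : {y | (x, y) ∈ T (k + 1)} ⊆ {y | (x, y) ∈ T k} \ {z} := by
          intro y hy
          have hy' : (x, y) ∈ T (k + 1) := hy
          rw [hTs] at hy'
          refine ⟨hy'.1, ?_⟩
          rintro rfl
          exact hy'.2 hz
        have h1 := Set.ncard_le_ncard hsub (hTf k x).sdiff
        have hz' : z ∈ {y | (x, y) ∈ T k} := hz.1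
        rw [Set.ncard_sdiff_singleton_of_mem hz'] at h1
        omega
      · have : {y | (x, y) ∈ T (k + 1)} = ∅ := by
          ext y
          simp only [Set.mem_empty_iff_false, iff_false]
          intro hy
          have hy' : (x, y) ∈ T (k + 1) := hy
          rw [hTs] at hy'
          exact hne ⟨y, hy'.1⟩
        rw [this]
        simp
  let e : ℕ → X → X := fun k x => if h : ∃ y, (x, y) ∈ minRel (T k) then h.choose else x
  have he : ∀ k x y, (x, y) ∈ minRel (T k) → e k x = y := by
    intro k x y hy
    have h : ∃ y, (x, y) ∈ minRel (T k) := ⟨y, hy⟩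
    simp only [e, dif_pos h]
    exact minRel_unique h.choose_spec hy
  have he' : ∀ k x, (¬ ∃ y, (x, y) ∈ minRel (T k)) → e k x = x := by
    intro k x h
    simp only [e, dif_neg h]
  refine ⟨e, fun k U hU => ?_, fun k x => ?_, fun x y hxy => ?_⟩
  · have hM := measurableSet_minRel (hTm k) (hTf k)
    have hproj : ∀ V : Set X, MeasurableSet V →
        MeasurableSet (Prod.fst '' (minRel (T k) ∩ Prod.snd ⁻¹' V)) := fun V hV =>
      (hM.inter (measurable_snd hV)).image_of_measurable_injOn measurable_fst
        ((injOn_fst_minRel _).mono Set.inter_subset_left)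
    have : e k ⁻¹' U = Prod.fst '' (minRel (T k) ∩ Prod.snd ⁻¹' U) ∪
        (U \ Prod.fst '' (minRel (T k) ∩ Prod.snd ⁻¹' Set.univ)) := by
      ext x
      by_cases h : ∃ y, (x, y) ∈ minRel (T k)
      · obtain ⟨y, hy⟩ := h
        simp only [Set.mem_preimage, he k x y hy, Set.mem_union, Set.mem_sdiff, Set.mem_image,
          Set.mem_inter_iff, Prod.exists, exists_and_right, exists_eq_right, Set.mem_univ, and_true]
        constructor
        · intro hyU
          exact Or.inl ⟨y, hy, hyU⟩
        · rintro (⟨z, hz, hzU⟩ | ⟨-, hn⟩)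
          · rwa [minRel_unique hy hz]
          · exact absurd ⟨y, hy⟩ hn
      · simp only [Set.mem_preimage, he' k x h, Set.mem_union, Set.mem_sdiff, Set.mem_image,
          Set.mem_inter_iff, Prod.exists, exists_and_right, exists_eq_right, Set.mem_univ, and_true]
        constructor
        · intro hxU
          exact Or.inr ⟨hxU, h⟩
        · rintro (⟨z, hz, -⟩ | ⟨hxU, -⟩)
          · exact absurd ⟨z, hz⟩ h
          · exact hxU
    rw [this]
    exact (hproj U hU).union (hU.diff (hproj _ MeasurableSet.univ))
  · by_cases h : ∃ y, (x, y) ∈ minRel (T k)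
    · obtain ⟨y, hy⟩ := h
      rw [he k x y hy]
      exact Or.inr (hTR k hy.1)
    · exact Or.inl (he' k x h)
  · by_contra hcon
    push Not at hcon
    have hall : ∀ k, (x, y) ∈ T k := by
      intro k
      induction k with
      | zero => exact hxy
      | succ k ih =>
        rw [hTs]
        exact ⟨ih, fun hm => hcon k (he k x y hm)⟩
    have h1 := hTc x {y | (x, y) ∈ R}.ncard
    rw [Nat.sub_self, Nat.le_zero, Set.ncard_eq_zero (hTf _ x)] at h1
    exact Set.eq_empty_iff_forall_notMem.1 h1 y (hall _)

/-! ### Forests generated by a function -/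

namespace SimpleGraph

/-- The graph of a function `f`, with every non-fixed vertex `x` joined to `f x`. -/
def functionGraph {V : Type*} (f : V → V) : SimpleGraph V :=
  SimpleGraph.fromRel fun x y => f x = y

theorem functionGraph_adj {V : Type*} {f : V → V} {x y : V} :
    (functionGraph f).Adj x y ↔ x ≠ y ∧ (f x = y ∨ f y = x) := by
  simp [functionGraph]

theorem functionGraph_reachable_iterate {V : Type*} (f : V → V) (x : V) (n : ℕ) :
    (functionGraph f).Reachable x (f^[n] x) := by
  induction n with
  | zero => exact Reachable.refl _
  | succ n ih =>
    rw [Function.iterate_succ_apply']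
    refine ih.trans ?_
    by_cases h : f^[n] x = f (f^[n] x)
    · rw [← h]
    · exact Adj.reachable (functionGraph_adj.2 ⟨h, Or.inl rfl⟩)

/-- Two vertices in the same component have forward orbits that merge. -/
theorem exists_iterate_eq_of_reachable {V : Type*} {f : V → V} {x y : V}
    (h : (functionGraph f).Reachable x y) : ∃ m n, f^[m] x = f^[n] y := by
  obtain ⟨p⟩ := h
  induction p with
  | nil => exact ⟨0, 0, rfl⟩
  | @cons u v w hadj p ih =>
    obtain ⟨m, n, hmn⟩ := ih
    rcases (functionGraph_adj.1 hadj).2 with h | h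
    · exact ⟨m + 1, n, by rw [Function.iterate_succ_apply, h, hmn]⟩
    · refine ⟨m, n + 1, ?_⟩
      rw [Function.iterate_succ_apply', ← hmn, ← Function.iterate_succ_apply' f,
        Function.iterate_succ_apply, h]

section Rank

variable {V : Type*} {f : V → V} {α : Type*} [LinearOrder α] {ρ : V → α}

theorem rank_le_rank_iterate (hρ : ∀ x, f x ≠ x → ρ x < ρ (f x)) (x : V) (n : ℕ) :
    ρ x ≤ ρ (f^[n] x) := by
  induction n with
  | zero => exact le_rfl
  | succ n ih =>
    rw [Function.iterate_succ_apply']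
    by_cases h : f (f^[n] x) = f^[n] x
    · rwa [h]
    · exact ih.trans (hρ _ h).le

theorem eq_of_iterate_apply_eq (hρ : ∀ x, f x ≠ x → ρ x < ρ (f x)) {x : V} {n : ℕ}
    (h : f^[n] (f x) = x) : f x = x := by
  by_contra hne
  have h1 := rank_le_rank_iterate hρ (f x) n
  rw [h] at h1
  exact absurd (hρ x hne) (not_lt.2 h1)

/-- If `f` increases a rank at every point it moves, then its graph is a forest: the backward orbit
of `x` is a union of components of the graph with the edge from `x` to `f x` removed, and it does
not contain `f x`. -/
theorem functionGraph_isAcyclic (hρ : ∀ x, f x ≠ x → ρ x < ρ (f x)) :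
    (functionGraph f).IsAcyclic := by
  have key : ∀ x, f x ≠ x → (functionGraph f).IsBridge s(x, f x) := by
    intro x hx
    rw [isBridge_iff]
    rintro ⟨p⟩
    have hclosed : ∀ u v, ((functionGraph f).deleteEdges {s(x, f x)}).Adj u v →
        (∃ k, f^[k] u = x) → ∃ k, f^[k] v = x := by
      rintro u v huv ⟨k, hk⟩
      rw [deleteEdges_adj] at huv
      rcases (functionGraph_adj.1 huv.1).2 with h | h
      · cases k with
        | zero =>
          obtain rfl : u = x := hk
          subst h
          exact absurd rfl huv.2
        | succ k => exact ⟨k, by rw [← h, ← Function.iterate_succ_apply, hk]⟩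
      · exact ⟨k + 1, by rw [Function.iterate_succ_apply, h, hk]⟩
    have hwalk : ∀ u v (_ : ((functionGraph f).deleteEdges {s(x, f x)}).Walk u v),
        (∃ k, f^[k] u = x) → ∃ k, f^[k] v = x := by
      intro u v q
      induction q with
      | nil => exact id
      | cons hadj _ ih => exact fun h => ih (hclosed _ _ hadj h)
    obtain ⟨k, hk⟩ := hwalk _ _ p ⟨0, rfl⟩
    exact hx (eq_of_iterate_apply_eq hρ hk)
  rw [isAcyclic_iff_forall_adj_isBridge]
  intro v w hvw
  obtain ⟨hne, h | h⟩ := functionGraph_adj.1 hvw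
  · rw [← h]
    exact key v (by rw [h]; exact hne.symm)
  · rw [← h, Sym2.eq_swap]
    exact key w (by rw [h]; exact hne)

/-- Backward orbits are finite, by induction along the well-founded rank: the backward orbit of
`x` consists of `x` and the backward orbits of its finitely many other preimages, which have smaller
rank. -/
theorem finite_setOf_iterate_eq [WellFoundedLT α] (hρ : ∀ x, f x ≠ x → ρ x < ρ (f x))
    (hfin : ∀ x, {y | f y = x}.Finite) (x : V) : {y | ∃ k, f^[k] y = x}.Finite := by
  induction hr : ρ x using WellFoundedLT.induction generalizing x with
  | ind r ih =>
    have hsub : {y | ∃ k, f^[k] y = x} ⊆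
        {x} ∪ ⋃ z ∈ {z | f z = x} \ {x}, {y | ∃ k, f^[k] y = z} := by
      rintro y ⟨k, hk⟩
      induction k with
      | zero => exact Or.inl hk
      | succ k ihk =>
        rw [Function.iterate_succ_apply'] at hk
        by_cases h : f^[k] y = x
        · exact ihk h
        · exact Or.inr (Set.mem_biUnion (x := f^[k] y) ⟨hk, h⟩ ⟨k, rfl⟩)
    refine Set.Finite.subset ((Set.finite_singleton x).union
      ((hfin x).sdiff.biUnion fun z hz => ih (ρ z) ?_ z rfl)) hsub
    have h1 : f z = x := hz.1
    have h2 : z ≠ x := hz.2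
    rw [← hr, ← h1]
    exact hρ z (by rw [h1]; exact h2.symm)

/-- A vertex outside the backward orbits of a finite set `K` has a forward orbit avoiding `K`, and
any two forward orbits merge; so all but finitely many vertices lie in a single component of the
complement of `K`, and that component is the value at `K` of the only end. -/
theorem isOneEnded_of_function {H : SimpleGraph V} [Nonempty V] [WellFoundedLT α]
    (hH : ∀ x, H.Adj x (f x)) (hmerge : ∀ x y, ∃ m n, f^[m] x = f^[n] y)
    (hρ : ∀ x, ρ x < ρ (f x)) (hfin : ∀ x, {y | f y = x}.Finite) : H.IsOneEnded := by
  classical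
  have hρ' : ∀ x, f x ≠ x → ρ x < ρ (f x) := fun x _ => hρ x
  let B : Finset V → Set V := fun K => ⋃ z ∈ K, {y | ∃ k, f^[k] y = z}
  have hBfin : ∀ K, (B K).Finite := fun K =>
    K.finite_toSet.biUnion fun z _ => finite_setOf_iterate_eq hρ' hfin z
  have hBmem : ∀ K y, y ∉ B K → ∀ k, f^[k] y ∉ K := by
    intro K y hy k hk
    exact hy (Set.mem_biUnion hk ⟨k, rfl⟩)
  have hKB : ∀ (K : Finset V) y, y ∉ B K → y ∉ (K : Set V) := fun K y hy => hBmem K y hy 0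
  have hmono : ∀ K L : Finset V, K ⊆ L → B K ⊆ B L := fun K L h =>
    Set.biUnion_subset_biUnion_left h
  have hiter : ∀ (K : Finset V) y (hy : y ∉ B K) k,
      H.componentComplMk (hKB K y hy) =
        H.componentComplMk (K := (K : Set V)) (v := f^[k] y) (hBmem K y hy k) := by
    intro K y hy k
    induction k with
    | zero => rfl
    | succ k ih =>
      rw [ih]
      refine componentComplMk_eq_of_adj H _ _ ?_
      rw [Function.iterate_succ_apply']
      exact hH _
  have hsame : ∀ (K : Finset V) y z (hy : y ∉ B K) (hz : z ∉ B K),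
      H.componentComplMk (hKB K y hy) = H.componentComplMk (hKB K z hz) := by
    intro K y z hy hz
    obtain ⟨m, n, hmn⟩ := hmerge y z
    rw [hiter K y hy m, hiter K z hz n]
    congr 1
  have hinf : Infinite V := by
    obtain ⟨x⟩ := ‹Nonempty V›
    refine Infinite.of_injective (fun n : ℕ => f^[n] x) ?_
    have : StrictMono fun n : ℕ => ρ (f^[n] x) := strictMono_nat_of_lt_succ fun n => by
      rw [Function.iterate_succ_apply']
      exact hρ _
    exact fun m n h => this.injective (congrArg ρ h)
  have hex : ∀ K, ∃ y, y ∉ B K := fun K => (hBfin K).infinite_compl.nonempty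
  choose v hv using hex
  refine ⟨fun K => H.componentComplMk (hKB K.unop (v K.unop) (hv K.unop)), ?_, ?_⟩
  · intro K L h
    have hLK : (L.unop : Finset V) ⊆ K.unop := CategoryTheory.le_of_op_hom h
    exact hsame L.unop (v K.unop) (v L.unop) (fun hm => hv K.unop (hmono _ _ hLK hm)) (hv L.unop)
  · intro s hs
    funext K
    let L : Finset V := K.unop ∪ (hBfin K.unop).toFinset
    have hKL : K.unop ⊆ L := Finset.subset_union_left
    obtain ⟨w, hw, hws⟩ := (s (Opposite.op L)).exists_eq_mk
    have hwB : w ∉ B K.unop := fun hm => hw (by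
      simp only [L, Finset.coe_union, Set.Finite.coe_toFinset, Set.mem_union]
      exact Or.inr hm)
    have h1 := end_hom_mk_of_mk H hs (CategoryTheory.opHomOfLE hKL) hw hws.symm
    exact h1.trans (hsame K.unop w (v K.unop) hwB (hv K.unop))

/-- A component of the graph of `f` without fixed points of `f` is one-ended, if `f` is
finite-to-one and increases a well-founded rank. -/
theorem functionGraph_component_isOneEnded [WellFoundedLT α]
    (hρ : ∀ x, f x ≠ x → ρ x < ρ (f x)) (hfin : ∀ x, {y | f y = x}.Finite) (x : V)
    (hx : ∀ y, (functionGraph f).Reachable x y → f y ≠ y) :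
    ((functionGraph f).connectedComponentMk x).toSimpleGraph.IsOneEnded := by
  set c := (functionGraph f).connectedComponentMk x with hc
  have hmem : ∀ y, y ∈ c ↔ (functionGraph f).Reachable x y := fun y => by
    rw [hc]
    refine ConnectedComponent.eq.trans ?_
    exact ⟨Reachable.symm, Reachable.symm⟩
  have hstep : ∀ y, y ∈ c → f y ∈ c := fun y hy =>
    (hmem _).2 (((hmem _).1 hy).trans (functionGraph_reachable_iterate f y 1))
  let g : c → c := fun y => ⟨f y.1, hstep y.1 y.2⟩
  have hg : ∀ n y, ((g^[n] y : c) : V) = f^[n] y.1 := by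
    intro n y
    induction n with
    | zero => rfl
    | succ n ih => rw [Function.iterate_succ_apply', Function.iterate_succ_apply', ← ih]
  have hne : ∀ y : c, f y.1 ≠ y.1 := fun y => hx y.1 ((hmem _).1 y.2)
  have : Nonempty c := ⟨⟨x, (hmem x).2 (Reachable.refl _)⟩⟩
  refine isOneEnded_of_function (f := g) (ρ := fun y => ρ y.1) ?_ ?_ ?_ ?_
  · intro y
    exact functionGraph_adj.2 ⟨(hne y).symm, Or.inl rfl⟩
  · intro y z
    obtain ⟨m, n, h⟩ := exists_iterate_eq_of_reachable
      (((hmem y.1).1 y.2).symm.trans ((hmem z.1).1 z.2))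
    exact ⟨m, n, Subtype.ext (by rw [hg, hg, h])⟩
  · exact fun y => hρ y.1 (hne y)
  · intro y
    refine ((hfin y.1).preimage Subtype.val_injective.injOn).subset fun z hz => ?_
    exact congrArg Subtype.val (show g z = y from hz)

end Rank

end SimpleGraph

/-! ### Borel enumerations of neighbours and balls -/

namespace SimpleGraph

/-- A countable family of Borel functions enumerating, at each vertex `x`, the neighbours of `x`
together with `x` itself; the function with index `0` is the identity. -/
structure IsNeighborEnumeration {X : Type*} [MeasurableSpace X] (G : SimpleGraph X)
    (e : ℕ → X → X) : Prop where
  measurable : ∀ k, Measurable (e k)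
  zero : ∀ x, e 0 x = x
  eq_or_adj : ∀ k x, e k x = x ∨ G.Adj x (e k x)
  exists_eq : ∀ x y, G.Adj x y → ∃ k, e k x = y

theorem exists_isNeighborEnumeration {X : Type u} [MeasurableSpace X] [StandardBorelSpace X]
    {G : SimpleGraph X} (hBorel : G.IsBorel) (hfin : G.IsLocFinite) :
    ∃ e, G.IsNeighborEnumeration e := by
  obtain ⟨e, h1, h2, h3⟩ := exists_measurable_enumeration (R := {p : X × X | G.Adj p.1 p.2})
    hBorel fun x => hfin x
  refine ⟨fun k => Nat.casesOn k id e, ?_, fun x => rfl, ?_, ?_⟩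
  · rintro (_ | k)
    · exact measurable_id
    · exact h1 k
  · rintro (_ | k) x
    · exact Or.inl rfl
    · exact h2 k x
  · intro x y h
    obtain ⟨k, hk⟩ := h3 x y h
    exact ⟨k + 1, hk⟩

/-- The functions `ballEnum e r i` for `i : ℕ` are the compositions of `r` members of the family
`e`. When `e` enumerates neighbours, their values at `x` are the vertices of the ball of radius `r`
around `x`. -/
def ballEnum {X : Type*} (e : ℕ → X → X) : ℕ → ℕ → X → X
  | 0, _, x => x
  | r + 1, i, x => ballEnum e r i.unpair.2 (e i.unpair.1 x)

variable {X : Type u} [MeasurableSpace X] {G : SimpleGraph X} {e : ℕ → X → X}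

namespace IsNeighborEnumeration

theorem measurable_ballEnum (he : G.IsNeighborEnumeration e) (r i : ℕ) :
    Measurable (ballEnum e r i) := by
  induction r generalizing i with
  | zero => exact measurable_id
  | succ r ih => exact (ih _).comp (he.measurable _)

theorem exists_ballEnum_eq_iff (he : G.IsNeighborEnumeration e) {r : ℕ} {x y : X} :
    (∃ i, ballEnum e r i x = y) ↔ G.edist x y ≤ r := by
  constructor
  · rintro ⟨i, rfl⟩
    induction r generalizing i x with
    | zero => simp [ballEnum]
    | succ r ih =>
      refine (G.edist_triangle (v := e i.unpair.1 x)).trans ?_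
      rw [Nat.cast_succ, add_comm]
      refine add_le_add (ih _) ?_
      rw [edist_le_one_iff_adj_or_eq]
      exact (he.eq_or_adj i.unpair.1 x).symm.imp id Eq.symm
  · intro h
    obtain ⟨p, hp⟩ := exists_walk_of_edist_ne_top (ne_top_of_le_ne_top (ENat.natCast_ne_top r) h)
    rw [← hp, Nat.cast_le] at h
    clear hp
    induction p generalizing r with
    | nil =>
      clear h
      induction r with
      | zero => exact ⟨0, rfl⟩
      | succ r ih =>
        obtain ⟨i, hi⟩ := ih
        exact ⟨Nat.pair 0 i, by simp [ballEnum, he.zero, hi]⟩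
    | cons hadj p ih =>
      cases r with
      | zero => simp at h
      | succ r =>
        obtain ⟨i, hi⟩ := ih (r := r) (by simpa using h)
        obtain ⟨k, hk⟩ := he.exists_eq _ _ hadj
        exact ⟨Nat.pair k i, by simp [ballEnum, hk, hi]⟩

theorem range_ballEnum (he : G.IsNeighborEnumeration e) (r : ℕ) (x : X) :
    Set.range (fun i => ballEnum e r i x) = G.graphBall x r := by
  ext y
  exact he.exists_ballEnum_eq_iff

theorem reachable_ballEnum (he : G.IsNeighborEnumeration e) (r i : ℕ) (x : X) :
    G.Reachable x (ballEnum e r i x) :=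
  reachable_of_edist_ne_top
    (ne_top_of_le_ne_top (ENat.natCast_ne_top r) (he.exists_ballEnum_eq_iff.1 ⟨i, rfl⟩))

theorem exists_ballEnum_eq_of_reachable (he : G.IsNeighborEnumeration e) {x y : X}
    (h : G.Reachable x y) : ∃ m : ℕ, ballEnum e m.unpair.1 m.unpair.2 x = y := by
  obtain ⟨p⟩ := h
  obtain ⟨i, hi⟩ := he.exists_ballEnum_eq_iff.2 (edist_le p)
  exact ⟨Nat.pair p.length i, by simpa using hi⟩

end IsNeighborEnumeration

theorem IsLocFinite.finite_graphBall (hfin : G.IsLocFinite) (he : G.IsNeighborEnumeration e)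
    (x : X) (r : ℕ) : (G.graphBall x r).Finite := by
  rw [← he.range_ballEnum]
  induction r generalizing x with
  | zero => exact (Set.finite_singleton x).subset (by rintro _ ⟨i, rfl⟩; rfl)
  | succ r ih =>
    refine (((Set.finite_singleton x).union (hfin x)).biUnion fun z _ => ih z).subset ?_
    rintro _ ⟨i, rfl⟩
    exact Set.mem_biUnion (x := e i.unpair.1 x) (he.eq_or_adj _ _) ⟨i.unpair.2, rfl⟩

/-- A Borel maximal set of vertices at pairwise distance greater than `r`. Vertices are added
greedily in countably many rounds; in the round of the rational interval `(a, b)` the candidates are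
the vertices that are the only point of their `r`-ball mapped to `(a, b)` by `embeddingReal X`. -/
theorem exists_measurableSet_separated_dense [StandardBorelSpace X] (hfin : G.IsLocFinite)
    (he : G.IsNeighborEnumeration e) (r : ℕ) :
    ∃ C : Set X, MeasurableSet C ∧ (∀ x, ∃ y ∈ C, G.edist x y ≤ r) ∧
      ∀ x ∈ C, ∀ y ∈ C, G.edist x y ≤ r → x = y := by
  classical
  have hj := measurableEmbedding_embeddingReal X
  obtain ⟨q, hq⟩ := exists_surjective_nat (ℚ × ℚ)
  let U : ℕ → Set X := fun i =>
    embeddingReal X ⁻¹' Set.Ioo ((q i).1 : ℝ) ((q i).2 : ℝ)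
  have hU : ∀ i, MeasurableSet (U i) := fun i => hj.measurable measurableSet_Ioo
  let A : ℕ → Set X := fun i => U i ∩ {x | ∀ k, ballEnum e r k x ∈ U i → ballEnum e r k x = x}
  have hAm : ∀ i, MeasurableSet (A i) := by
    intro i
    refine (hU i).inter ?_
    have : {x | ∀ k, ballEnum e r k x ∈ U i → ballEnum e r k x = x} =
        ⋂ k, ((ballEnum e r k ⁻¹' U i)ᶜ ∪ {x | ballEnum e r k x = x}) := by
      ext x
      simp [imp_iff_not_or]
    rw [this]
    exact MeasurableSet.iInter fun k => ((he.measurable_ballEnum r k) (hU i)).compl.union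
      (measurableSet_eq_fun (he.measurable_ballEnum r k) measurable_id)
  have hAd : ∀ i x y, x ∈ A i → y ∈ A i → G.edist x y ≤ r → x = y := by
    intro i x y hx hy hxy
    obtain ⟨k, hk⟩ := he.exists_ballEnum_eq_iff.2 hxy
    have := hx.2 k (by rw [hk]; exact hy.1)
    rw [← this, hk]
  have hAc : ∀ x, ∃ i, x ∈ A i := by
    intro x
    have hF : (embeddingReal X '' (G.graphBall x r \ {x})).Finite :=
      ((hfin.finite_graphBall he x r).sdiff).image _
    have hx : (embeddingReal X '' (G.graphBall x r \ {x}))ᶜ ∈ nhds (embeddingReal X x) := by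
      refine hF.isClosed.isOpen_compl.mem_nhds ?_
      rintro ⟨y, hy, hyx⟩
      exact hy.2 (hj.injective hyx)
    obtain ⟨a, b, hab, hsub⟩ := mem_nhds_iff_exists_Ioo_subset.1 hx
    obtain ⟨a', ha1, ha2⟩ := exists_rat_btwn hab.1
    obtain ⟨b', hb1, hb2⟩ := exists_rat_btwn hab.2
    obtain ⟨i, hi⟩ := hq (a', b')
    refine ⟨i, ?_, fun k hk => ?_⟩
    · change embeddingReal X x ∈ Set.Ioo _ _
      rw [hi]
      exact ⟨ha2, hb1⟩
    · by_contra hne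
      have hk' : embeddingReal X (ballEnum e r k x) ∈ Set.Ioo ((q i).1 : ℝ) ((q i).2 : ℝ) := hk
      rw [hi] at hk'
      exact hsub ⟨ha1.trans hk'.1, hk'.2.trans hb2⟩
        ⟨_, ⟨he.exists_ballEnum_eq_iff.1 ⟨k, rfl⟩, hne⟩, rfl⟩
  let D : ℕ → Set X := fun i => Nat.rec (motive := fun _ => Set X) ∅
    (fun i D => D ∪ (A i ∩ ⋂ k, (ballEnum e r k ⁻¹' D)ᶜ)) i
  have hD : ∀ i, D (i + 1) = D i ∪ (A i ∩ ⋂ k, (ballEnum e r k ⁻¹' D i)ᶜ) := fun i => rfl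
  have hDm : ∀ i, MeasurableSet (D i) := by
    intro i
    induction i with
    | zero => exact MeasurableSet.empty
    | succ i ih =>
      rw [hD]
      exact ih.union ((hAm i).inter
        (MeasurableSet.iInter fun k => (he.measurable_ballEnum r k ih).compl))
  have hDmono : Monotone D := monotone_nat_of_le_succ fun i => by
    rw [hD]; exact Set.subset_union_left
  have hnew : ∀ i x y, x ∈ ⋂ k, (ballEnum e r k ⁻¹' D i)ᶜ → y ∈ D i → ¬ G.edist x y ≤ r := by
    intro i x y hx hy hxy
    obtain ⟨k, rfl⟩ := he.exists_ballEnum_eq_iff.2 hxy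
    exact Set.mem_iInter.1 hx k hy
  have hDd : ∀ i x y, x ∈ D i → y ∈ D i → G.edist x y ≤ r → x = y := by
    intro i
    induction i with
    | zero => intro x y hx; exact hx.elim
    | succ i ih =>
      intro x y hx hy hxy
      rw [hD] at hx hy
      rcases hx with hx | hx <;> rcases hy with hy | hy
      · exact ih x y hx hy hxy
      · exact absurd (edist_comm.trans_le hxy) (hnew i y x hy.2 hx)
      · exact absurd hxy (hnew i x y hx.2 hy)
      · exact hAd i x y hx.1 hy.1 hxy
  refine ⟨⋃ i, D i, MeasurableSet.iUnion hDm, fun x => ?_, fun x hx y hy hxy => ?_⟩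
  · obtain ⟨i, hi⟩ := hAc x
    by_cases h : ∃ k : ℕ, ballEnum e r k x ∈ D i
    · obtain ⟨k, hk⟩ := h
      exact ⟨_, Set.mem_iUnion.2 ⟨i, hk⟩, he.exists_ballEnum_eq_iff.1 ⟨k, rfl⟩⟩
    · refine ⟨x, Set.mem_iUnion.2 ⟨i + 1, ?_⟩, by simp⟩
      rw [hD]
      exact Or.inr ⟨hi, Set.mem_iInter.2 fun k hk => h ⟨k, hk⟩⟩
  · obtain ⟨i, hi⟩ := Set.mem_iUnion.1 hx
    obtain ⟨j, hj⟩ := Set.mem_iUnion.1 hy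
    exact hDd (max i j) x y (hDmono (le_max_left i j) hi) (hDmono (le_max_right i j) hj) hxy

/-- If every vertex is within distance `R` of the Borel set `C`, there are a Borel function `d`
bounded by `R` and vanishing on `C`, namely the distance to `C`, and a Borel function `g` that moves
each vertex outside `C` to a neighbour at which `d` is smaller. -/
theorem exists_measurable_step_toward (he : G.IsNeighborEnumeration e) {C : Set X}
    (hC : MeasurableSet C) {R : ℕ} (hdense : ∀ x, ∃ y ∈ C, G.edist x y ≤ R) :
    ∃ (d : X → ℕ) (g : X → X), Measurable g ∧ (∀ x, d x ≤ R) ∧ (∀ x ∈ C, g x = x) ∧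
      (∀ x, d x = 0 → x ∈ C) ∧ (∀ x, g x = x ∨ G.Adj x (g x)) ∧
      ∀ x ∉ C, d (g x) < d x := by
  classical
  have hex : ∀ x, ∃ r, ∃ i, ballEnum e r i x ∈ C := by
    intro x
    obtain ⟨y, hy, hxy⟩ := hdense x
    obtain ⟨i, rfl⟩ := he.exists_ballEnum_eq_iff.2 hxy
    exact ⟨R, i, hy⟩
  let d : X → ℕ := fun x => Nat.find (hex x)
  have hd : Measurable d := by
    refine measurable_find hex fun r => ?_
    rw [Set.ofPred_exists]
    exact MeasurableSet.iUnion fun i => he.measurable_ballEnum r i hC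
  have hdC : ∀ x ∈ C, d x = 0 := fun x hx => (Nat.find_eq_zero _).2 ⟨0, hx⟩
  have hstep : ∀ x, ∃ k, x ∈ C ∧ k = 0 ∨ x ∉ C ∧ d (e k x) < d x := by
    intro x
    by_cases hx : x ∈ C
    · exact ⟨0, Or.inl ⟨hx, rfl⟩⟩
    · obtain ⟨i, hi⟩ := Nat.find_spec (hex x)
      obtain ⟨r, hr⟩ : ∃ r, Nat.find (hex x) = r + 1 := by
        refine Nat.exists_eq_succ_of_ne_zero fun h0 => hx ?_
        rw [h0] at hi
        exact hi
      rw [hr] at hi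
      refine ⟨i.unpair.1, Or.inr ⟨hx, ?_⟩⟩
      change d (e i.unpair.1 x) < Nat.find (hex x)
      rw [hr]
      exact Nat.lt_succ_of_le (Nat.find_min' _ ⟨i.unpair.2, hi⟩)
  let κ : X → ℕ := fun x => Nat.find (hstep x)
  have hκ : Measurable κ := by
    refine measurable_find hstep fun k => ?_
    refine MeasurableSet.union (hC.inter (MeasurableSet.const _)) (hC.compl.inter ?_)
    exact measurableSet_lt (hd.comp (he.measurable k)) hd
  refine ⟨d, fun x => e (κ x) x, ?_, ?_, ?_, ?_, fun x => he.eq_or_adj _ _, ?_⟩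
  · exact (measurable_from_prod_countable_right (f := fun p : ℕ × X => e p.1 p.2)
      he.measurable).comp (hκ.prodMk measurable_id)
  · intro x
    obtain ⟨y, hy, hxy⟩ := hdense x
    obtain ⟨i, rfl⟩ := he.exists_ballEnum_eq_iff.2 hxy
    exact Nat.find_min' _ ⟨i, hy⟩
  · intro x hx
    have h0 : κ x = 0 := (Nat.find_eq_zero _).2 (Or.inl ⟨hx, rfl⟩)
    simp only [h0, he.zero]
  · intro x hx
    obtain ⟨i, hi⟩ := (Nat.find_eq_zero _).1 hx
    exact hi
  · intro x hx
    rcases Nat.find_spec (hstep x) with h | h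
    · exact absurd h.1 hx
    · exact h.2

/-! ### Consequences of measure preservation -/

/-- A Borel function moving points inside their components is countable-to-one, so it has a Borel
section over the image of `A`; the section is injective and maps into `A`. -/
theorem IsMeasurePreserving.measure_image_le [StandardBorelSpace X] {μ : Measure X}
    (hpres : G.IsMeasurePreserving μ)
    (he : G.IsNeighborEnumeration e) {A : Set X} (hA : MeasurableSet A) {g : X → X}
    (hg : Measurable g) (hgr : ∀ x, G.Reachable x (g x)) :
    MeasurableSet (g '' A) ∧ μ (g '' A) ≤ μ A := by
  classical
  let φ : ℕ → X → X := fun m => ballEnum e m.unpair.1 m.unpair.2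
  have hφ : ∀ m, Measurable (φ m) := fun m => he.measurable_ballEnum _ _
  let p : X → ℕ → Prop := fun y m => φ m y ∈ A ∧ g (φ m y) = y
  have hpm : ∀ m, MeasurableSet {y | p y m} := fun m =>
    (hφ m hA).inter (measurableSet_eq_fun (hg.comp (hφ m)) measurable_id)
  have hiff : ∀ y, y ∈ g '' A ↔ ∃ m, p y m := by
    intro y
    constructor
    · rintro ⟨x, hx, rfl⟩
      obtain ⟨m, hm⟩ := he.exists_ballEnum_eq_of_reachable (hgr x).symm
      refine ⟨m, ?_, ?_⟩ <;> simp only [φ, hm]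
      exact hx
    · rintro ⟨m, h1, h2⟩
      exact ⟨_, h1, h2⟩
  have himg : g '' A = ⋃ m, {y | p y m} := by
    ext y
    rw [hiff, Set.mem_iUnion]
    rfl
  have hmeas : MeasurableSet (g '' A) := by
    rw [himg]
    exact MeasurableSet.iUnion hpm
  refine ⟨hmeas, ?_⟩
  -- `h` is a Borel section of `g` over `g '' A`.
  have hex : ∀ y, ∃ m, p y m ∨ y ∉ g '' A := by
    intro y
    by_cases hy : y ∈ g '' A
    · obtain ⟨m, hm⟩ := (hiff y).1 hy
      exact ⟨m, Or.inl hm⟩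
    · exact ⟨0, Or.inr hy⟩
  let κ : X → ℕ := fun y => Nat.find (hex y)
  have hκ : Measurable κ := measurable_find hex fun m => (hpm m).union hmeas.compl
  let h : X → X := fun y => φ (κ y) y
  have hh : Measurable h :=
    (measurable_from_prod_countable_right (f := fun q : ℕ × X => φ q.1 q.2) hφ).comp
      (hκ.prodMk measurable_id)
  have hsec : ∀ y ∈ g '' A, h y ∈ A ∧ g (h y) = y := fun y hy =>
    (Nat.find_spec (hex y)).resolve_right (not_not.2 hy)
  rw [← hpres (g '' A) h hmeas hh
    (fun y hy z hz hyz => by rw [← (hsec y hy).2, hyz, (hsec z hz).2])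
    (fun y _ => he.reachable_ballEnum _ _ _)]
  refine measure_mono ?_
  rintro _ ⟨y, hy, rfl⟩
  exact (hsec y hy).1

/-- The balls of radius `s` around the points of a `2 s`-separated set are disjoint, so the measure
of the set is at most the inverse of the least size of such a ball. -/
theorem IsMeasurePreserving.mul_measure_le_one [StandardBorelSpace X] {μ : Measure X}
    [IsProbabilityMeasure μ] (hpres : G.IsMeasurePreserving μ) (he : G.IsNeighborEnumeration e)
    {C : Set X} (hC : MeasurableSet C) {s : ℕ}
    (hsep : ∀ x ∈ C, ∀ y ∈ C, G.edist x y ≤ (2 * s : ℕ) → x = y)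
    {N : ℝ} (hN : ∀ x, N ≤ ((G.graphBall x s).ncard : ℝ)) :
    ENNReal.ofReal N * μ C ≤ 1 := by
  classical
  -- On `A i` the value of `ballEnum e s i` differs from those of the functions before it.
  let A : ℕ → Set X := fun i => {x | ∀ j < i, ballEnum e s j x ≠ ballEnum e s i x}
  have hA : ∀ i, MeasurableSet (A i) := by
    intro i
    simp only [A, Set.ofPred_forall]
    exact MeasurableSet.iInter fun j => MeasurableSet.iInter fun _ =>
      (measurableSet_eq_fun (he.measurable_ballEnum s j) (he.measurable_ballEnum s i)).compl
  have hcount : ∀ x, ENNReal.ofReal N ≤ ∑' i, (A i).indicator (fun _ => (1 : ENNReal)) x := by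
    intro x
    have hfirst : ∀ y ∈ G.graphBall x s, ∃ i, ballEnum e s i x = y := fun y hy =>
      he.exists_ballEnum_eq_iff.2 hy
    choose! ι hι using fun y (hy : y ∈ G.graphBall x s) =>
      (⟨Nat.find (hfirst y hy), Nat.find_spec (hfirst y hy), fun j hj =>
        Nat.find_min (hfirst y hy) hj⟩ :
        ∃ i, ballEnum e s i x = y ∧ ∀ j < i, ballEnum e s j x ≠ y)
    by_cases hf : (G.graphBall x s).Finite
    · let I : Finset ℕ := hf.toFinset.image ι
      have hI : I.card = (G.graphBall x s).ncard := by
        rw [Finset.card_image_of_injOn, Set.ncard_eq_toFinset_card _ hf]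
        intro y hy z hz hyz
        rw [← (hι y (by simpa using hy)).1, hyz, (hι z (by simpa using hz)).1]
      calc ENNReal.ofReal N ≤ ENNReal.ofReal ((G.graphBall x s).ncard : ℝ) :=
            ENNReal.ofReal_le_ofReal (hN x)
        _ = (I.card : ENNReal) := by rw [ENNReal.ofReal_natCast, hI]
        _ = ∑ i ∈ I, (A i).indicator (fun _ => (1 : ENNReal)) x := by
            rw [Finset.sum_congr rfl fun i hi => Set.indicator_of_mem (s := A i) ?_ _]
            · simp
            · obtain ⟨y, hy, rfl⟩ := Finset.mem_image.1 hi
              have hy' := hι y (by simpa using hy)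
              intro j hj
              rw [hy'.1]
              exact hy'.2 j hj
        _ ≤ _ := ENNReal.sum_le_tsum I
    · have : N ≤ 0 := by
        have := hN x
        rwa [Set.Infinite.ncard hf, Nat.cast_zero] at this
      rw [ENNReal.ofReal_of_nonpos this]
      exact zero_le
  have hball : ∀ x ∈ C, ∀ y ∈ C, ∀ i j, ballEnum e s i x = ballEnum e s j y → x = y := by
    intro x hx y hy i j hij
    refine hsep x hx y hy ?_
    have h1 := (he.exists_ballEnum_eq_iff (r := s) (x := x)).1 ⟨i, rfl⟩
    have h2 := (he.exists_ballEnum_eq_iff (r := s) (x := y)).1 ⟨j, rfl⟩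
    rw [hij] at h1
    rw [edist_comm] at h2
    refine G.edist_triangle.trans ((add_le_add h1 h2).trans (le_of_eq ?_))
    rw [two_mul]
    push_cast
    rfl
  have hinj : ∀ i, Set.InjOn (ballEnum e s i) (C ∩ A i) := fun i x hx y hy hxy =>
    hball x hx.1 y hy.1 i i hxy
  have himg : ∀ i, MeasurableSet (ballEnum e s i '' (C ∩ A i)) := fun i =>
    (hC.inter (hA i)).image_of_measurable_injOn (he.measurable_ballEnum s i) (hinj i)
  have hdisj : Pairwise (Function.onFun Disjoint fun i => ballEnum e s i '' (C ∩ A i)) := by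
    have hlt : ∀ i j, i < j →
        Disjoint (ballEnum e s i '' (C ∩ A i)) (ballEnum e s j '' (C ∩ A j)) := by
      intro i j hij
      rw [Set.disjoint_left]
      rintro _ ⟨x, hx, rfl⟩ ⟨y, hy, hxy⟩
      obtain rfl := hball y hy.1 x hx.1 j i hxy
      exact hy.2 i hij hxy.symm
    intro i j hij
    rcases lt_or_gt_of_ne hij with h | h
    · exact hlt i j h
    · exact (hlt j i h).symm
  calc ENNReal.ofReal N * μ C = ∫⁻ _ in C, ENNReal.ofReal N ∂μ := by
        rw [setLIntegral_const]
    _ ≤ ∫⁻ x in C, ∑' i, (A i).indicator (fun _ => (1 : ENNReal)) x ∂μ :=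
        lintegral_mono hcount
    _ = ∑' i, ∫⁻ x in C, (A i).indicator (fun _ => (1 : ENNReal)) x ∂μ :=
        lintegral_tsum fun i => (measurable_const.indicator (hA i)).aemeasurable
    _ = ∑' i, μ (ballEnum e s i '' (C ∩ A i)) := by
        refine tsum_congr fun i => ?_
        rw [lintegral_indicator_const (hA i), one_mul, Measure.restrict_apply (hA i),
          hpres (C ∩ A i) _ (hC.inter (hA i)) (he.measurable_ballEnum s i) (hinj i)
            fun x _ => he.reachable_ballEnum s i x, Set.inter_comm]
    _ = μ (⋃ i, ballEnum e s i '' (C ∩ A i)) := (measure_iUnion hdisj himg).symm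
    _ ≤ 1 := prob_le_one

end SimpleGraph

/-! ### Gluing the steps together -/

/-- Glues a sequence of functions along the last index `n` with `x ∈ P n`; a point that lies in
infinitely many of the sets, or in none of them, is fixed. -/
theorem exists_measurable_glue_last {X : Type*} [MeasurableSpace X] {P : ℕ → Set X}
    {g : ℕ → X → X} (hP : ∀ n, MeasurableSet (P n)) (hg : ∀ n, Measurable (g n)) :
    ∃ f : X → X, Measurable f ∧
      (∀ n x, x ∈ P n → (∀ m > n, x ∉ P m) → f x = g n x) ∧
      ∀ x, (¬ ∃ n, x ∈ P n ∧ ∀ m > n, x ∉ P m) → f x = x := by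
  classical
  let W : ℕ → Set X := fun n => P n ∩ ⋂ m, ⋂ (_ : m > n), (P m)ᶜ
  have hWmem : ∀ n x, x ∈ W n ↔ x ∈ P n ∧ ∀ m > n, x ∉ P m := by
    intro n x
    simp [W]
  have hW : ∀ n, MeasurableSet (W n) := fun n => (hP n).inter
    (MeasurableSet.iInter fun m => MeasurableSet.iInter fun _ => (hP m).compl)
  have huniq : ∀ x m n, x ∈ W m → x ∈ W n → m = n := by
    intro x m n hm hn
    rw [hWmem] at hm hn
    rcases lt_trichotomy m n with h | h | h
    · exact absurd hn.1 (hm.2 n h)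
    · exact h
    · exact absurd hm.1 (hn.2 m h)
  let f : X → X := fun x => if h : ∃ n, x ∈ W n then g h.choose x else x
  have hf : ∀ n x, x ∈ W n → f x = g n x := by
    intro n x hx
    have h : ∃ n, x ∈ W n := ⟨n, hx⟩
    simp only [f, dif_pos h]
    rw [huniq x _ _ h.choose_spec hx]
  have hf' : ∀ x, (¬ ∃ n, x ∈ W n) → f x = x := by
    intro x h
    simp only [f, dif_neg h]
  refine ⟨f, fun U hU => ?_, fun n x h1 h2 => hf n x ((hWmem n x).2 ⟨h1, h2⟩), fun x h => ?_⟩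
  · have : f ⁻¹' U = (⋃ n, W n ∩ g n ⁻¹' U) ∪ (U \ ⋃ n, W n) := by
      ext x
      simp only [Set.mem_preimage, Set.mem_union, Set.mem_iUnion, Set.mem_inter_iff,
        Set.mem_sdiff]
      by_cases h : ∃ n, x ∈ W n
      · obtain ⟨n, hn⟩ := h
        rw [hf n x hn]
        constructor
        · exact fun hx => Or.inl ⟨n, hn, hx⟩
        · rintro (⟨m, hm, hx⟩ | ⟨-, h⟩)
          · rwa [huniq x _ _ hn hm]
          · exact absurd ⟨n, hn⟩ h
      · rw [hf' x h]
        constructor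
        · exact fun hx => Or.inr ⟨hx, h⟩
        · rintro (⟨m, hm, -⟩ | ⟨hx, -⟩)
          · exact absurd ⟨m, hm⟩ h
          · exact hx
    rw [this]
    exact (MeasurableSet.iUnion fun n => (hW n).inter (hg n hU)).union
      (hU.diff (MeasurableSet.iUnion hW))
  · refine hf' x ?_
    rintro ⟨n, hn⟩
    exact h ⟨n, (hWmem n x).1 hn⟩

namespace SimpleGraph

variable {X : Type u} [MeasurableSpace X] {G : SimpleGraph X} {e : ℕ → X → X}

/-- Given Borel sets `C n`, each point being within distance `R n` of `C n`, such that the total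
measure of the paths of length at most `R (n + 1)` from the points of `C n` to `C (n + 1)` is
finite, there is a one-ended spanning subforest. A vertex `x` moves along the path of the largest
index `n` for which it lies on one; the rank that increases is this index followed by the progress
towards `C (n + 1)`. -/
theorem exists_oneEndedSpanningSubforest_of_summable [StandardBorelSpace X] {μ : Measure X}
    (hfin : G.IsLocFinite) (hpres : G.IsMeasurePreserving μ)
    (he : G.IsNeighborEnumeration e) {C : ℕ → Set X} {R : ℕ → ℕ} (hC : ∀ n, MeasurableSet (C n))
    (hdense : ∀ n x, ∃ y ∈ C n, G.edist x y ≤ R n) (hC0 : ∀ x, x ∈ C 0)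
    (hsum : ∑' n, ((R (n + 1) : ENNReal) + 1) * μ (C n) ≠ ⊤) :
    ∃ T : SimpleGraph X, G.IsBorelAEOneEndedSpanningSubforest μ T := by
  classical
  choose d g hgm hdR hgC hdC hgadj hdlt using fun n =>
    exists_measurable_step_toward he (hC (n + 1)) (hdense (n + 1))
  have hgr : ∀ n x, G.Reachable x (g n x) := by
    intro n x
    rcases hgadj n x with h | h
    · rw [h]
    · exact h.reachable
  have hgkr : ∀ n k x, G.Reachable x ((g n)^[k] x) := by
    intro n k x
    induction k with
    | zero => exact Reachable.refl _
    | succ k ih =>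
      rw [Function.iterate_succ_apply']
      exact ih.trans (hgr n _)
  have hgkm : ∀ n k, Measurable ((g n)^[k]) := fun n k => (hgm n).iterate k
  -- `P n` is the union of the paths from the points of `C n` to `C (n + 1)`.
  let P : ℕ → Set X := fun n => ⋃ k ∈ Finset.range (R (n + 1) + 1), (g n)^[k] '' C n
  have himg : ∀ n k, MeasurableSet ((g n)^[k] '' C n) ∧ μ ((g n)^[k] '' C n) ≤ μ (C n) :=
    fun n k => hpres.measure_image_le he (hC n) (hgkm n k) (hgkr n k)
  have hPm : ∀ n, MeasurableSet (P n) := fun n =>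
    Finset.measurableSet_biUnion _ fun k _ => (himg n k).1
  have hPμ : ∀ n, μ (P n) ≤ ((R (n + 1) : ENNReal) + 1) * μ (C n) := by
    intro n
    refine (measure_biUnion_finset_le _ _).trans
      ((Finset.sum_le_sum fun k _ => (himg n k).2).trans (le_of_eq ?_))
    simp
  have hCP : ∀ n, C n ⊆ P n := fun n x hx =>
    Set.mem_biUnion (x := 0) (Finset.mem_coe.2 (Finset.mem_range.2 (Nat.succ_pos _))) ⟨x, hx, rfl⟩
  have hgP : ∀ n x, x ∈ P n → g n x ∈ P n := by
    intro n x hx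
    simp only [P, Set.mem_iUnion, Finset.mem_range, exists_prop] at hx ⊢
    obtain ⟨k, hk, z, hz, rfl⟩ := hx
    have hbound : ∀ k, (g n)^[k] z ∈ C (n + 1) ∨ d n ((g n)^[k] z) + k ≤ R (n + 1) := by
      intro k
      induction k with
      | zero => exact Or.inr (hdR n z)
      | succ k ih =>
        rw [Function.iterate_succ_apply']
        by_cases hm : (g n)^[k] z ∈ C (n + 1)
        · exact Or.inl (by rwa [hgC n _ hm])
        · have := hdlt n _ hm
          have := ih.resolve_left hm
          exact Or.inr (by omega)
    by_cases hm : (g n)^[k] z ∈ C (n + 1)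
    · exact ⟨k, hk, z, hz, (hgC n _ hm).symm⟩
    · refine ⟨k + 1, ?_, z, hz, Function.iterate_succ_apply' _ _ _⟩
      have h1 := (hbound k).resolve_left hm
      have h2 : d n ((g n)^[k] z) ≠ 0 := fun h0 => hm (hdC n _ h0)
      omega
  obtain ⟨f, hfm, hfg, hfbad⟩ := exists_measurable_glue_last hPm hgm
  let Last : X → ℕ → Prop := fun x n => x ∈ P n ∧ ∀ m > n, x ∉ P m
  have hfadj : ∀ x, f x = x ∨ G.Adj x (f x) := by
    intro x
    by_cases h : ∃ n, Last x n
    · obtain ⟨n, hn⟩ := h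
      rw [hfg n x hn.1 hn.2]
      exact hgadj n x
    · exact Or.inl (hfbad x h)
  have hLast_unique : ∀ x m n, Last x m → Last x n → m = n := by
    intro x m n hm hn
    rcases lt_trichotomy m n with h | h | h
    · exact absurd hn.1 (hm.2 n h)
    · exact h
    · exact absurd hm.1 (hn.2 m h)
  have hLastC : ∀ x n, Last x n → x ∉ C (n + 1) := fun x n h hx =>
    h.2 (n + 1) (Nat.lt_succ_self n) (hCP _ hx)
  let ρ : X → ℕ∞ ×ₗ ℕ := fun x =>
    if h : ∃ n, Last x n then toLex ((h.choose : ℕ∞), R (h.choose + 1) - d h.choose x)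
    else toLex (⊤, 0)
  have hρn : ∀ x n, Last x n → ρ x = toLex ((n : ℕ∞), R (n + 1) - d n x) := by
    intro x n hn
    have h : ∃ n, Last x n := ⟨n, hn⟩
    simp only [ρ, dif_pos h]
    rw [hLast_unique x _ _ h.choose_spec hn]
  have hρ : ∀ x, f x ≠ x → ρ x < ρ (f x) := by
    intro x hx
    have h : ∃ n, Last x n := by
      by_contra h
      exact hx (hfbad x h)
    obtain ⟨n, hn⟩ := h
    have hfx : f x = g n x := hfg n x hn.1 hn.2
    have hfP : f x ∈ P n := by rw [hfx]; exact hgP n x hn.1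
    rw [hρn x n hn]
    by_cases h' : ∃ m, Last (f x) m
    · obtain ⟨m, hm⟩ := h'
      rw [hρn _ m hm, Prod.Lex.toLex_lt_toLex]
      have hnm : n ≤ m := by
        by_contra hlt
        exact hm.2 n (not_le.1 hlt) hfP
      rcases hnm.lt_or_eq with hlt | rfl
      · exact Or.inl (Nat.cast_lt.2 hlt)
      · refine Or.inr ⟨rfl, ?_⟩
        have h1 := hdlt n x (hLastC x n hn)
        have h2 := hdR n x
        rw [← hfx] at h1
        change R (n + 1) - d n x < R (n + 1) - d n (f x)
        omega
    · simp only [ρ, dif_neg h']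
      rw [Prod.Lex.toLex_lt_toLex]
      exact Or.inl (ENat.natCast_lt_top n)
  have hffin : ∀ x, {y | f y = x}.Finite := by
    intro x
    refine ((Set.finite_singleton x).union (hfin x)).subset fun y hy => ?_
    have hy' : f y = x := hy
    rcases hfadj y with h | h
    · exact Or.inl (h.symm.trans hy')
    · exact Or.inr (by rw [hy'] at h; exact h.symm)
  have hle : functionGraph f ≤ G := by
    intro x y hxy
    obtain ⟨hne, h | h⟩ := functionGraph_adj.1 hxy
    · have := (hfadj x).resolve_left (by rw [h]; exact hne.symm)
      rwa [h] at this
    · have := (hfadj y).resolve_left (by rw [h]; exact hne)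
      rw [h] at this
      exact this.symm
  let N : Set X := {x | ∃ᶠ n in Filter.atTop, x ∈ P n}
  have hN0 : μ N = 0 := measure_setOfPred_frequently_eq_zero
    (ne_top_of_le_ne_top hsum (ENNReal.tsum_le_tsum hPμ))
  have hfixed : ∀ y, f y = y → y ∈ N := by
    intro y hy
    by_contra hyN
    have hev : ∀ᶠ n in Filter.atTop, y ∉ P n := Filter.not_frequently.1 hyN
    obtain ⟨n₀, hn₀⟩ := Filter.eventually_atTop.1 hev
    -- Since `C 0` is everything, `y` lies in some `P n`, and then in a last one.
    have hl : Last y (Nat.findGreatest (fun n => y ∈ P n) n₀) := by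
      refine ⟨Nat.findGreatest_spec (P := fun n => y ∈ P n) (Nat.zero_le n₀) (hCP 0 (hC0 y)),
        fun m hm hmP => ?_⟩
      rcases le_total m n₀ with h | h
      · exact Nat.findGreatest_is_greatest hm h hmP
      · exact hn₀ m h hmP
    have h1 := hdlt _ y (hLastC y _ hl)
    rw [← hfg _ y hl.1 hl.2, hy] at h1
    exact lt_irrefl _ h1
  obtain ⟨N', hNN', hN'm, hN'0⟩ := exists_measurable_superset_of_null hN0
  -- The saturation of a null set is null.
  have hsat : μ (⋃ m : ℕ, ballEnum e m.unpair.1 m.unpair.2 '' N') = 0 := by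
    refine measure_iUnion_null fun m => ?_
    refine le_antisymm ?_ zero_le
    rw [← hN'0]
    exact (hpres.measure_image_le he hN'm (he.measurable_ballEnum _ _)
      (he.reachable_ballEnum _ _)).2
  refine ⟨functionGraph f, hle, ?_, functionGraph_isAcyclic hρ, ?_⟩
  · have : {p : X × X | (functionGraph f).Adj p.1 p.2} =
        {p : X × X | p.1 = p.2}ᶜ ∩ ({p : X × X | f p.1 = p.2} ∪ {p : X × X | f p.2 = p.1}) := by
      ext p
      exact functionGraph_adj
    rw [IsBorel, this]
    exact (measurableSet_eq_fun measurable_fst measurable_snd).compl.inter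
      ((measurableSet_eq_fun (hfm.comp measurable_fst) measurable_snd).union
        (measurableSet_eq_fun (hfm.comp measurable_snd) measurable_fst))
  · have hae : ∀ᵐ x ∂μ, x ∉ ⋃ m : ℕ, ballEnum e m.unpair.1 m.unpair.2 '' N' :=
      measure_eq_zero_iff_ae_notMem.1 hsat
    filter_upwards [hae] with x hx
    refine functionGraph_component_isOneEnded hρ hffin x fun y hxy hy => hx ?_
    obtain ⟨m, hm⟩ := he.exists_ballEnum_eq_of_reachable (hxy.mono hle).symm
    exact Set.mem_iUnion.2 ⟨m, y, hNN' (hfixed y hy), hm⟩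

end SimpleGraph

theorem mainTheorem12 {X : Type*} [MeasurableSpace X] [StandardBorelSpace X]
    (μ : Measure X) [IsProbabilityMeasure μ] (G : SimpleGraph X)
    (hBorel : G.IsBorel) (hfin : G.IsLocFinite) (hpres : G.IsMeasurePreserving μ)
    (hgrowth : ∃ c : ℝ, 0 < c ∧
      ∀ (x : X) (r : ℕ), c * (r : ℝ) ^ 2 ≤ ((G.graphBall x r).ncard : ℝ)) :
    ∃ T : SimpleGraph X, G.IsBorelAEOneEndedSpanningSubforest μ T := by
  obtain ⟨c, hc, hgr⟩ := hgrowth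
  obtain ⟨e, he⟩ := SimpleGraph.exists_isNeighborEnumeration hBorel hfin
  -- Taking `C n` to be `2 n ^ 2`-separated makes `μ (C n)` of order `n ^ (-4)`, while the paths
  -- from `C n` to `C (n + 1)` have length of order `n ^ 2`. For `n = 0` the set is everything.
  choose C hC hdense hsep using fun n : ℕ =>
    SimpleGraph.exists_measurableSet_separated_dense hfin he (2 * n ^ 2)
  refine SimpleGraph.exists_oneEndedSpanningSubforest_of_summable hfin hpres he
    (R := fun n => 2 * n ^ 2) hC hdense (fun x => ?_) ?_
  · obtain ⟨y, hy, hxy⟩ := hdense 0 x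
    have : x = y := by simpa using hxy
    rwa [this]
  · have hμ : ∀ n : ℕ, μ (C (n + 1)) ≤ ENNReal.ofReal (c * ((n + 1 : ℕ) : ℝ) ^ 4)⁻¹ := by
      intro n
      have hpos : 0 < c * ((n + 1 : ℕ) : ℝ) ^ 4 := by positivity
      have h := hpres.mul_measure_le_one he (hC (n + 1)) (hsep (n + 1))
        (N := c * ((n + 1 : ℕ) : ℝ) ^ 4) fun x => by
          refine le_trans (le_of_eq ?_) (hgr x ((n + 1) ^ 2))
          push_cast
          ring
      rw [ENNReal.ofReal_inv_of_pos hpos, ENNReal.le_inv_iff_mul_le, mul_comm]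
      exact h
    have hterm : ∀ n : ℕ, (((2 * (n + 1 + 1) ^ 2 : ℕ) : ENNReal) + 1) * μ (C (n + 1)) ≤
        ENNReal.ofReal (9 / c * (1 / ((n + 1 : ℕ) : ℝ) ^ 2)) := by
      intro n
      have hcast : (((2 * (n + 1 + 1) ^ 2 : ℕ) : ENNReal) + 1) =
          ENNReal.ofReal (2 * ((n : ℝ) + 2) ^ 2 + 1) := by
        have : 2 * ((n : ℝ) + 2) ^ 2 + 1 = ((2 * (n + 1 + 1) ^ 2 : ℕ) : ℝ) + 1 := by
          push_cast
          ring
        rw [this, ENNReal.ofReal_add (by positivity) zero_le_one, ENNReal.ofReal_natCast,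
          ENNReal.ofReal_one]
      rw [hcast]
      refine (mul_le_mul_right (hμ n) _).trans ?_
      rw [← ENNReal.ofReal_mul (by positivity)]
      refine ENNReal.ofReal_le_ofReal ?_
      have hn : (0 : ℝ) < ((n + 1 : ℕ) : ℝ) := by positivity
      have h9 : 2 * ((n : ℝ) + 2) ^ 2 + 1 ≤ 9 * ((n + 1 : ℕ) : ℝ) ^ 2 := by
        push_cast
        nlinarith [Nat.cast_nonneg (α := ℝ) n]
      calc (2 * ((n : ℝ) + 2) ^ 2 + 1) * (c * ((n + 1 : ℕ) : ℝ) ^ 4)⁻¹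
          ≤ 9 * ((n + 1 : ℕ) : ℝ) ^ 2 * (c * ((n + 1 : ℕ) : ℝ) ^ 4)⁻¹ := by gcongr
        _ = 9 / c * (1 / ((n + 1 : ℕ) : ℝ) ^ 2) := by field_simp
    have hsummable : Summable fun n : ℕ => 9 / c * (1 / ((n + 1 : ℕ) : ℝ) ^ 2) :=
      ((summable_nat_add_iff 1).2 (Real.summable_one_div_nat_pow.2 one_lt_two)).mul_left _
    rw [tsum_eq_zero_add' ENNReal.summable]
    refine ENNReal.add_ne_top.2 ⟨ENNReal.mul_ne_top (by simp) (measure_ne_top _ _), ?_⟩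
    exact ne_top_of_le_ne_top hsummable.tsum_ofReal_ne_top (ENNReal.tsum_le_tsum hterm)
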